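/- Lattices are considered with the two binary operations $\vee$, $\wedge$ only, and the variety of a lattice $L$ is the class of all lattices that satisfy every lattice identity valid in $L$. In a lattice $M$, a \emph{point} is an element $p$ such that the set of all elements strictly smaller than $p$ has a largest element. A finite subset $E$ of $M$ \emph{covers} $p$ if $E$ has a join and $p\le\bigvee E$; a set $X$ \emph{refines} a set $Y$ if every element of $X$ is below some element of $Y$; a finite set $E$ covers $p$ \emph{minimally} if it covers $p$ and $E\subseteq X$ for every finite $X$ that covers $p$ and refines $E$. The lattice $M$ is \emph{strongly spatial} if every element of $M$ is a (possibly empty or infinite) join of points and, for every point $p$ and every finite $X$ covering $p$, there is a finite set $I$ of points that refines $X$ and covers $p$ minimally. The lattice $M$ is \emph{algebraic} if it is complete and every element is a join of compact elements. \textbf{Corollary.} For every modular lattice $L$ there are an algebraic strongly spatial lattice $M$ that belongs to the variety of $L$ and an injective lattice homomorphism $f\colon L\to M$. If $L$ has a least element $0_L$, then $M$ and $f$ can be chosen such that $f(0_L)$ is the least element of $M$. -/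

import Mathlib

universe u

/-- Lattice terms: formal expressions built from variables indexed by `ℕ` with the two binary
operation symbols of join and meet (no constants). -/
inductive LatticeTerm : Type
  | var : ℕ → LatticeTerm
  | join : LatticeTerm → LatticeTerm → LatticeTerm
  | meet : LatticeTerm → LatticeTerm → LatticeTerm

/-- The value of a lattice term in the lattice `L` under the assignment `v` of the variables. -/
def LatticeTerm.eval {L : Type*} [Lattice L] (v : ℕ → L) : LatticeTerm → L
  | LatticeTerm.var i => v i
  | LatticeTerm.join s t => LatticeTerm.eval v s ⊔ LatticeTerm.eval v t
  | LatticeTerm.meet s t => LatticeTerm.eval v s ⊓ LatticeTerm.eval v t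

/-- A lattice identity `s = t`, given by the pair of its two sides. -/
abbrev LatticeIdentity : Type := LatticeTerm × LatticeTerm

/-- The lattice `L` is a member of the lattice variety defined by the set `E` of identities:
every identity of `E` holds in `L` under every assignment. -/
def InLatticeVariety (E : Set LatticeIdentity) (L : Type*) [Lattice L] : Prop :=
  ∀ e ∈ E, ∀ v : ℕ → L, e.1.eval v = e.2.eval v

/-- The lattice `M` belongs to the variety of the lattice `L`, that is, to the lattice variety
generated by `L`: every lattice variety that contains `L` contains `M`. -/
def InVarietyOf (M L : Type*) [Lattice M] [Lattice L] : Prop :=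
  ∀ E : Set LatticeIdentity, InLatticeVariety E L → InLatticeVariety E M

/-- A point, or completely join-irreducible element: the set of all elements
(strictly) smaller than `p` has a largest element. -/
def IsLatticePoint {L : Type*} [PartialOrder L] (p : L) : Prop :=
  ∃ q, IsGreatest {x : L | x < p} q

/-- A join-irreducible element: `p` belongs to every finite set of which it is the join
(the empty set included, so that `p` is not the zero of `L`). -/
def IsJoinIrreducible {L : Type*} [SemilatticeSup L] (p : L) : Prop :=
  ∀ X : Finset L, IsLUB (X : Set L) p → p ∈ X

/-- Join-density: every element is the join of some (possibly empty) set of elements of `S`. -/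
def IsJoinDense {L : Type*} [PartialOrder L] (S : Set L) : Prop :=
  ∀ a : L, ∃ T : Set L, T ⊆ S ∧ IsLUB T a

/-- The finite set `E` is a join-cover of `p`: it has a join, and `p` lies below that join.
(A nonempty finite set always has a join; the empty set has one iff `L` has a zero.) -/
def IsJoinCover {L : Type*} [SemilatticeSup L] (p : L) (E : Finset L) : Prop :=
  ∃ b : L, IsLUB (E : Set L) b ∧ p ≤ b

/-- `X` refines `Y`: every element of `X` lies below some element of `Y`. -/
def JoinRefines {L : Type*} [PartialOrder L] (X Y : Finset L) : Prop :=
  ∀ x ∈ X, ∃ y ∈ Y, x ≤ y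

/-- `E` is a minimal join-cover of `p`: it is a join-cover of `p`, and it is contained in each
join-cover of `p` that refines it. (Such an `E` never contains the zero of `L`.) -/
def IsMinimalJoinCover {L : Type*} [SemilatticeSup L] (p : L) (E : Finset L) : Prop :=
  IsJoinCover p E ∧ ∀ X : Finset L, IsJoinCover p X → JoinRefines X E → E ⊆ X

/-- A seed: a join-dense set of join-irreducible elements such that every join-cover of an element
`p` of the set is refined by a minimal join-cover of `p` consisting of elements of the set. -/
structure IsLatticeSeed {L : Type*} [SemilatticeSup L] (S : Set L) : Prop where
  joinDense : IsJoinDense S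
  joinIrreducible : ∀ p ∈ S, IsJoinIrreducible p
  exists_minimal : ∀ p ∈ S, ∀ X : Finset L, IsJoinCover p X →
    ∃ I : Finset L, IsMinimalJoinCover p I ∧ (I : Set L) ⊆ S ∧ JoinRefines I X

/-- A strongly spatial lattice: the set of all its points is a seed. -/
def IsStronglySpatial (L : Type*) [SemilatticeSup L] : Prop :=
  IsLatticeSeed {p : L | IsLatticePoint p}

/-- An algebraic lattice: a complete lattice in which every element is a join of compact
elements. -/
def IsAlgebraicLattice (L : Type*) [CompleteLattice L] : Prop :=
  IsCompactlyGenerated L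

/-! Under reverse inclusion, the filter lattice `N` of `L` contains `L` and lies in its variety, so
it is modular. Since unions of chains of filters are filters, Zorn's lemma gives `N` enough points
and shrinks `q` in `p ≤ q ⊔ r` to a minimal element. If `p` is a point not below `r`, modularity
makes this minimal element a point (`IsLatticePoint.of_minimal`).

Algebraicity comes from passing to the ideals of the join-semilattice of finite joins of points of
`N`. The map `PointJoins.belowHom` preserves joins because a cover of a point by two elements
shrinks to points or zeros. It reaches every principal ideal, and terms commute with directed unions
of ideals, so all identities of `N` survive. The points of the new lattice are the ideals `below p`,
and shrinking a cover one member at a time yields minimal covers. -/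

open Order

/-! ### Lattice terms, ideals and varieties -/

namespace LatticeTerm

theorem eval_mono {L : Type*} [Lattice L] (t : LatticeTerm) {v w : ℕ → L} (h : ∀ i, v i ≤ w i) :
    t.eval v ≤ t.eval w := by
  induction t with
  | var i => exact h i
  | join s t hs ht => exact sup_le_sup hs ht
  | meet s t hs ht => exact inf_le_inf hs ht

theorem map_eval {L M : Type*} [Lattice L] [Lattice M] (f : LatticeHom L M) (t : LatticeTerm)
    (v : ℕ → L) : f (t.eval v) = t.eval fun i => f (v i) := by
  induction t with
  | var i => rfl
  | join s t hs ht => simp only [eval, map_sup, hs, ht]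
  | meet s t hs ht => simp only [eval, map_inf, hs, ht]

/-- The dual term, with the two operation symbols exchanged. -/
def dual : LatticeTerm → LatticeTerm
  | var i => var i
  | join s t => meet (dual s) (dual t)
  | meet s t => join (dual s) (dual t)

theorem ofDual_eval {L : Type*} [Lattice L] (t : LatticeTerm) (v : ℕ → Lᵒᵈ) :
    OrderDual.ofDual (t.eval v) = t.dual.eval fun i => OrderDual.ofDual (v i) := by
  induction t with
  | var i => rfl
  | join s t hs ht => simp only [eval, dual, ofDual_sup, hs, ht]
  | meet s t hs ht => simp only [eval, dual, ofDual_inf, hs, ht]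

/-- Membership in the value of a term at a family of ideals is witnessed by principal ideals. -/
theorem mem_eval_ideal_iff {K : Type*} [SemilatticeSup K] [IsCodirectedOrder K] (t : LatticeTerm)
    (I : ℕ → Ideal K) (x : K) :
    x ∈ t.eval I ↔
      ∃ v : ℕ → K, (∀ i, v i ∈ I i) ∧ x ∈ t.eval fun i => Ideal.principal (v i) := by
  constructor
  · induction t generalizing x with
    | var i =>
      intro hx
      choose w hw using fun i => (I i).nonempty
      refine ⟨Function.update w i x, fun k => ?_, ?_⟩
      · by_cases hk : k = i
        · subst hk
          rw [Function.update_self]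
          exact hx
        · rw [Function.update_of_ne hk]
          exact hw k
      · simp [eval]
    | join s t hs ht =>
      rintro ⟨a, ha, b, hb, hx⟩
      obtain ⟨v, hv, hav⟩ := hs a ha
      obtain ⟨w, hw, hbw⟩ := ht b hb
      -- Terms are monotone and ideals directed, so one assignment serves both subterms.
      refine ⟨fun i => v i ⊔ w i, fun i => Ideal.sup_mem (hv i) (hw i), a, ?_, b, ?_, hx⟩
      · exact eval_mono s (fun i => Ideal.principal_le_iff.2
          (Ideal.mem_principal.2 (le_sup_left : v i ≤ v i ⊔ w i))) hav
      · exact eval_mono t (fun i => Ideal.principal_le_iff.2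
          (Ideal.mem_principal.2 (le_sup_right : w i ≤ v i ⊔ w i))) hbw
    | meet s t hs ht =>
      rintro ⟨ha, hb⟩
      obtain ⟨v, hv, hav⟩ := hs x ha
      obtain ⟨w, hw, hbw⟩ := ht x hb
      refine ⟨fun i => v i ⊔ w i, fun i => Ideal.sup_mem (hv i) (hw i), ?_, ?_⟩
      · exact eval_mono s (fun i => Ideal.principal_le_iff.2
          (Ideal.mem_principal.2 (le_sup_left : v i ≤ v i ⊔ w i))) hav
      · exact eval_mono t (fun i => Ideal.principal_le_iff.2
          (Ideal.mem_principal.2 (le_sup_right : w i ≤ v i ⊔ w i))) hbw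
  · rintro ⟨v, hv, hx⟩
    exact eval_mono t (fun i => Ideal.principal_le_iff.2 (hv i)) hx

end LatticeTerm

/-- If the principal ideals of `K` are values of a lattice homomorphism from `N`, then the ideal
lattice of `K` belongs to the variety of `N`. -/
theorem inVarietyOf_ideal {N K : Type*} [Lattice N] [SemilatticeSup K] [IsCodirectedOrder K]
    (g : LatticeHom N (Ideal K)) (j : K → N) (hg : ∀ k, g (j k) = Ideal.principal k) :
    InVarietyOf (Ideal K) N := by
  intro E hE e he I
  refine SetLike.ext fun x => ?_
  -- Principal ideals are values of `g`, so identities of `N` hold at them.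
  have key : ∀ v : ℕ → K, (e.1.eval fun i => Ideal.principal (v i)) =
      e.2.eval fun i => Ideal.principal (v i) := by
    intro v
    simp only [← hg]
    rw [← LatticeTerm.map_eval, ← LatticeTerm.map_eval, hE e he]
  rw [LatticeTerm.mem_eval_ideal_iff,
    LatticeTerm.mem_eval_ideal_iff]
  simp only [key]

theorem InVarietyOf.trans {A B C : Type*} [Lattice A] [Lattice B] [Lattice C]
    (h : InVarietyOf A B) (h' : InVarietyOf B C) : InVarietyOf A C :=
  fun E hE => h E (h' E hE)

theorem InVarietyOf.dual {M L : Type*} [Lattice M] [Lattice L] (h : InVarietyOf M Lᵒᵈ) :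
    InVarietyOf Mᵒᵈ L := by
  intro E hE e he v
  have h' := h {(e.1.dual, e.2.dual)} (by
    rintro _ rfl w
    have := hE e he fun i => OrderDual.ofDual (w i)
    rw [← OrderDual.ofDual_inj, LatticeTerm.ofDual_eval, LatticeTerm.ofDual_eval]
    have hdd : ∀ t : LatticeTerm, t.dual.dual = t := by
      intro t
      induction t with
      | var i => rfl
      | join s t hs ht => simp only [LatticeTerm.dual, hs, ht]
      | meet s t hs ht => simp only [LatticeTerm.dual, hs, ht]
    simpa only [hdd] using this) _ rfl fun i => OrderDual.ofDual (v i)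
  rw [← OrderDual.ofDual_inj, LatticeTerm.ofDual_eval, LatticeTerm.ofDual_eval]
  exact h'

/-- Replacing `x` by `x ⊓ z` turns the modular law for `x ≤ z` into an identity. -/
theorem InVarietyOf.isModularLattice {M L : Type*} [Lattice M] [Lattice L] [IsModularLattice L]
    (h : InVarietyOf M L) : IsModularLattice M := by
  let x := LatticeTerm.var 0
  let y := LatticeTerm.var 1
  let z := LatticeTerm.var 2
  have h' := h {(((x.meet z).join y).meet z, (x.meet z).join (y.meet z))} (by
    rintro _ rfl v
    exact (sup_inf_assoc_of_le (v 1) (inf_le_right : v 0 ⊓ v 2 ≤ v 2)))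
  refine ⟨fun {a} b {c} hac => ?_⟩
  have h₁ : (a ⊓ c ⊔ b) ⊓ c = a ⊓ c ⊔ b ⊓ c :=
    h' _ rfl fun i => if i = 0 then a else if i = 1 then b else c
  rw [inf_eq_left.2 hac] at h₁
  exact h₁.le

/-! ### Points and minimal complements -/

theorem IsLatticePoint.isJoinIrreducible {L : Type*} [SemilatticeSup L] {p : L}
    (hp : IsLatticePoint p) : IsJoinIrreducible p := by
  obtain ⟨s, hs, hmax⟩ := hp
  intro X hX
  by_contra h
  refine (lt_of_le_of_lt (hX.2 fun x hx => hmax (lt_of_le_of_ne (hX.1 hx) ?_)) hs).false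
  rintro rfl
  exact h hx

/-- If `q` is minimal with `p ≤ q ⊔ r` in a modular lattice, where `p` is a point not below `r`,
then `q` is a point. -/
theorem IsLatticePoint.of_minimal {N : Type*} [Lattice N] [IsModularLattice N] {p q r : N}
    (hp : IsLatticePoint p) (h : p ≤ q ⊔ r) (hr : ¬ p ≤ r)
    (hmin : ∀ x ≤ q, p ≤ x ⊔ r → x = q) : IsLatticePoint q := by
  obtain ⟨s, hs, hmax⟩ := hp
  have hs' : s < p := hs
  have hqp : q ≤ p ⊔ r := by
    refine inf_eq_right.1 (hmin ((p ⊔ r) ⊓ q) inf_le_right ?_)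
    have h₁ := sup_inf_assoc_of_le q (le_sup_right : r ≤ p ⊔ r)
    calc p ≤ (r ⊔ q) ⊓ (p ⊔ r) := le_inf (h.trans (sup_comm q r).le) le_sup_left
      _ = r ⊔ q ⊓ (p ⊔ r) := h₁
      _ = (p ⊔ r) ⊓ q ⊔ r := by rw [sup_comm, inf_comm]
  have hpr : p ⊓ r ≤ s := hmax (lt_of_le_of_ne inf_le_left fun e => hr (inf_eq_left.1 e))
  have hps : ¬ p ≤ s ⊔ r := by
    intro hle
    have h₁ := sup_inf_assoc_of_le r hs'.le
    rw [inf_eq_right.2 hle, inf_comm, sup_eq_left.2 hpr] at h₁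
    exact hs'.ne' h₁
  -- The lower cover `s` of `p` is carried over to `q` by perspectivity through `r`.
  refine ⟨q ⊓ (s ⊔ r), lt_of_le_of_ne inf_le_left fun e => hps ?_, fun x hx => ?_⟩
  · exact h.trans (sup_le (inf_eq_left.1 e) le_sup_right)
  · have hxq : x < q := hx
    have hy : p ⊓ (x ⊔ r) ≤ s :=
      hmax (lt_of_le_of_ne inf_le_left fun e => hxq.ne (hmin x hxq.le (inf_eq_left.1 e)))
    refine le_inf hxq.le ?_
    have h₁ := sup_inf_assoc_of_le p (le_sup_right : r ≤ x ⊔ r)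
    rw [inf_eq_right.2 (sup_le (hxq.le.trans (hqp.trans (sup_comm p r).le)) le_sup_left)] at h₁
    calc x ≤ x ⊔ r := le_sup_left
      _ = r ⊔ p ⊓ (x ⊔ r) := h₁
      _ ≤ s ⊔ r := sup_le le_sup_right (hy.trans le_sup_left)

/-- Whenever `p ≤ q ⊔ r`, the element `q` can be shrunk to a minimal one with this property. -/
def HasMinimalComplements (N : Type*) [Lattice N] : Prop :=
  ∀ p q r : N, p ≤ q ⊔ r → ∃ q' ≤ q, p ≤ q' ⊔ r ∧ ∀ x ≤ q', p ≤ x ⊔ r → x = q'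

/-- The directed union of a nonempty chain of ideals. -/
theorem Order.Ideal.exists_chain_union {Q : Type*} [Preorder Q] {C : Set (Ideal Q)}
    (hC : IsChain (· ≤ ·) C) (hne : C.Nonempty) :
    ∃ U : Ideal Q, ∀ x, x ∈ U ↔ ∃ I ∈ C, x ∈ I := by
  obtain ⟨I₀, hI₀⟩ := hne
  obtain ⟨x₀, hx₀⟩ := I₀.nonempty
  refine ⟨{ carrier := {x | ∃ I ∈ C, x ∈ I}
            lower' := fun a b hba ⟨I, hI, ha⟩ => ⟨I, hI, I.lower hba ha⟩
            nonempty' := ⟨x₀, I₀, hI₀, hx₀⟩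
            directed' := ?_ }, fun x => Iff.rfl⟩
  rintro a ⟨I, hI, ha⟩ b ⟨J, hJ, hb⟩
  obtain h | h := hC.total hI hJ
  · obtain ⟨c, hc, hac, hbc⟩ := J.directed a (h ha) b hb
    exact ⟨c, ⟨J, hJ, hc⟩, hac, hbc⟩
  · obtain ⟨c, hc, hac, hbc⟩ := I.directed a ha b (h hb)
    exact ⟨c, ⟨I, hI, hc⟩, hac, hbc⟩

/-- Dually, `I ⊓ R ≤ P` persists under unions of chains of ideals `I`, so a maximal `I` exists. -/
theorem hasMinimalComplements_dual_ideal (Q : Type*) [Lattice Q] :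
    HasMinimalComplements (Ideal Q)ᵒᵈ := by
  intro p q r h
  let P : Ideal Q := OrderDual.ofDual p
  let R : Ideal Q := OrderDual.ofDual r
  obtain ⟨m, hqm, hm⟩ := zorn_le_nonempty₀ {I : Ideal Q | I ⊓ R ≤ P} (by
    intro C hC hchain I hI
    obtain ⟨U, hU⟩ := Ideal.exists_chain_union hchain ⟨I, hI⟩
    refine ⟨U, ?_, fun J hJ x hx => (hU x).2 ⟨J, hJ, hx⟩⟩
    rintro x ⟨hx, hxR⟩
    obtain ⟨J, hJ, hxJ⟩ := (hU x).1 hx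
    exact hC hJ ⟨hxJ, hxR⟩) (OrderDual.ofDual q) h
  exact ⟨OrderDual.toDual m, hqm, hm.prop, fun x hx hpx => (hm.eq_of_le hpx hx).symm⟩

/-- Points separate a principal filter from the filters not below it. -/
theorem exists_point_dual_ideal {Q : Type*} [Lattice Q] (a : (Ideal Q)ᵒᵈ) (b : Q)
    (h : ¬ a ≤ OrderDual.toDual (Ideal.principal b)) :
    ∃ p, IsLatticePoint p ∧ p ≤ a ∧ ¬ p ≤ OrderDual.toDual (Ideal.principal b) := by
  obtain ⟨m, ham, hm⟩ := zorn_le_nonempty₀ {I : Ideal Q | b ∉ I} (by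
    intro C hC hchain I hI
    obtain ⟨U, hU⟩ := Ideal.exists_chain_union hchain ⟨I, hI⟩
    refine ⟨U, ?_, fun J hJ x hx => (hU x).2 ⟨J, hJ, hx⟩⟩
    intro hx
    obtain ⟨J, hJ, hxJ⟩ := (hU b).1 hx
    exact hC hJ hxJ) (OrderDual.ofDual a) (fun hb => h (Ideal.principal_le_iff.2 hb))
  -- Each ideal properly containing `m` contains `b`, so `m ⊔ Ideal.principal b` is the least of
  -- them.
  refine ⟨OrderDual.toDual m, ⟨OrderDual.toDual (m ⊔ Ideal.principal b), ?_, ?_⟩, ham,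
    fun hb => hm.prop (Ideal.principal_le_iff.1 hb)⟩
  · exact Ideal.lt_sup_principal_of_notMem hm.prop
  · intro x hx
    have hx' : m < OrderDual.ofDual x := hx
    refine sup_le hx'.le (Ideal.principal_le_iff.2 ?_)
    by_contra hb
    exact hx'.ne (hm.eq_of_le hb hx'.le)

/-! ### Ideals of finite joins of points -/

section PointJoins

variable {N : Type*} [Lattice N] [OrderBot N]

theorem IsLatticePoint.of_minimal_of_ne_bot [IsModularLattice N] {p q r : N}
    (hp : IsLatticePoint p) (h : p ≤ q ⊔ r) (hmin : ∀ x ≤ q, p ≤ x ⊔ r → x = q) (hq : q ≠ ⊥) :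
    IsLatticePoint q :=
  hp.of_minimal h (fun hr => hq (hmin ⊥ bot_le (hr.trans le_sup_right)).symm) hmin

/-- Members are shrunk one by one. Shrinking a later one only lowers the complements of the others,
which preserves their minimality. The parameter `c` holds the members still to be treated. -/
theorem HasMinimalComplements.exists_minimal_family (hN : HasMinimalComplements N) {ι : Type*}
    [DecidableEq ι] (p : N) (f : ι → N) (s : Finset ι) (c : N) (h : p ≤ s.sup f ⊔ c) :
    ∃ g : ι → N, (∀ i ∈ s, g i ≤ f i) ∧ p ≤ s.sup g ⊔ c ∧
      ∀ i ∈ s, ∀ x ≤ g i, p ≤ x ⊔ ((s.erase i).sup g ⊔ c) → x = g i := by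
  induction s using Finset.induction_on generalizing c with
  | empty => exact ⟨f, by simp, h, by simp⟩
  | insert a s ha ih =>
    obtain ⟨g, hgf, hpg, hg⟩ := ih (f a ⊔ c) (by
      rwa [Finset.sup_insert, sup_comm (f a), sup_assoc] at h)
    obtain ⟨y, hyf, hpy, hy⟩ := hN p (f a) (s.sup g ⊔ c) (by
      rwa [sup_left_comm] at hpg)
    have hsup : ∀ t : Finset ι, a ∉ t → t.sup (Function.update g a y) = t.sup g := by
      intro t hat
      refine Finset.sup_congr rfl fun i hi => Function.update_of_ne ?_ _ _
      rintro rfl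
      exact hat hi
    refine ⟨Function.update g a y, fun i hi => ?_, ?_, fun i hi x hx hpx => ?_⟩
    · by_cases hia : i = a
      · subst hia
        simpa using hyf
      · simpa [hia] using hgf i (Finset.mem_of_mem_insert_of_ne hi hia)
    · rw [Finset.sup_insert, hsup s ha, Function.update_self, sup_assoc]
      exact hpy
    · by_cases hia : i = a
      · subst hia
        rw [Finset.erase_insert ha, hsup s ha] at hpx
        rw [Function.update_self] at hx ⊢
        exact hy x hx hpx
      · have his := Finset.mem_of_mem_insert_of_ne hi hia
        rw [Function.update_of_ne hia] at hx ⊢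
        refine hg i his x hx (hpx.trans (sup_le_sup le_rfl ?_))
        rw [Finset.erase_insert_of_ne (Ne.symm hia), Finset.sup_insert, Function.update_self,
          hsup _ fun h => ha (Finset.mem_of_mem_erase h)]
        refine sup_le (sup_le (hyf.trans ?_) le_sup_left) ?_
        · exact le_sup_left.trans le_sup_right
        · exact le_sup_right.trans le_sup_right

variable (N) in
/-- The join-semilattice of all finite joins of points. -/
abbrev PointJoins : Type _ :=
  {x : N // ∃ F : Finset N, (∀ f ∈ F, IsLatticePoint f) ∧ F.sup id = x}

instance : SemilatticeSup (PointJoins N) :=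
  Subtype.semilatticeSup (by
    classical
    rintro _ _ ⟨F, hF, rfl⟩ ⟨G, hG, rfl⟩
    refine ⟨F ∪ G, fun f hf => ?_, Finset.sup_union⟩
    exact (Finset.mem_union.1 hf).elim (hF f) (hG f))

instance : OrderBot (PointJoins N) :=
  Subtype.orderBot ⟨∅, by simp, rfl⟩

/-- A point, as a join of points. -/
def IsLatticePoint.toPointJoins {p : N} (hp : IsLatticePoint p) : PointJoins N :=
  ⟨p, {p}, by simpa using hp, by simp⟩

/-- An ideal contains an element when it contains all points below it. -/
theorem PointJoins.mem_of_forall_point {J : Ideal (PointJoins N)} {k : PointJoins N}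
    (h : ∀ (p : N) (hp : IsLatticePoint p), p ≤ k → hp.toPointJoins ∈ J) : k ∈ J := by
  classical
  obtain ⟨_, F, hF, rfl⟩ := k
  have key : ∀ G : Finset N, G ⊆ F → ∃ l ∈ J, (l : N) = G.sup id := by
    intro G
    induction G using Finset.induction_on with
    | empty => exact fun _ => ⟨⊥, J.bot_mem, rfl⟩
    | insert a G _ ih =>
      intro hG
      obtain ⟨l, hl, hlG⟩ := ih ((Finset.subset_insert a G).trans hG)
      have haF := hG (Finset.mem_insert_self a G)
      refine ⟨(hF a haF).toPointJoins ⊔ l,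
        Ideal.sup_mem (h a _ (Finset.le_sup (f := id) haF)) hl, ?_⟩
      rw [Finset.sup_insert, ← hlG]
      rfl
  obtain ⟨l, hl, e⟩ := key F subset_rfl
  convert hl
  exact e.symm

theorem PointJoins.ideal_le_of_forall_point {I J : Ideal (PointJoins N)}
    (h : ∀ (p : N) (hp : IsLatticePoint p), hp.toPointJoins ∈ I → hp.toPointJoins ∈ J) : I ≤ J :=
  fun _ hk => mem_of_forall_point fun p hp hpk => h p hp (I.lower hpk hk)

/-- The ideal of all finite joins of points below a given element. -/
def PointJoins.below (a : N) : Ideal (PointJoins N) where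
  carrier := {k | (k : N) ≤ a}
  lower' := fun _ _ h hk => le_trans h hk
  nonempty' := ⟨⊥, bot_le⟩
  directed' := fun k hk l hl => ⟨k ⊔ l, sup_le hk hl, le_sup_left, le_sup_right⟩

theorem PointJoins.below_coe (k : PointJoins N) : below (k : N) = Ideal.principal k := rfl

theorem PointJoins.below_mono {a b : N} (h : a ≤ b) : below a ≤ below b :=
  fun _ hk => le_trans hk h

/-- In a modular lattice with minimal complements, taking the finite joins of points below an
element is a lattice homomorphism. -/
def PointJoins.belowHom [IsModularLattice N] (hN : HasMinimalComplements N) :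
    LatticeHom N (Ideal (PointJoins N)) where
  toFun := below
  map_sup' a b := by
    refine le_antisymm (ideal_le_of_forall_point fun p hp h => ?_)
      (sup_le (below_mono le_sup_left) (below_mono le_sup_right))
    -- `q` is minimal against `b`, then `r` against `q`; each is a point or `⊥`.
    obtain ⟨q, hqa, hpq, hq⟩ := hN p a b h
    obtain ⟨r, hrb, hpr, hr⟩ := hN p b q (by rwa [sup_comm])
    have mem : ∀ {x y : N}, p ≤ x ⊔ y → (∀ z ≤ x, p ≤ z ⊔ y → z = x) →
        ∃ F : Finset N, (∀ f ∈ F, IsLatticePoint f) ∧ F.sup id = x := by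
      intro x y hxy hmin
      by_cases hx : x = ⊥
      · exact ⟨∅, by simp, by simp [hx]⟩
      · exact hp.of_minimal_of_ne_bot hxy hmin hx |>.toPointJoins.2
    exact ⟨⟨q, mem hpq hq⟩, hqa, ⟨r, mem hpr hr⟩, hrb, hpr.trans (sup_comm r q).le⟩
  map_inf' _ _ := SetLike.ext fun _ => le_inf_iff

theorem PointJoins.isAlgebraicLattice : IsAlgebraicLattice (Ideal (PointJoins N)) := by
  refine ⟨fun I => ⟨Ideal.principal '' (I : Set (PointJoins N)), ?_, ?_⟩⟩
  · rintro _ ⟨k, -, rfl⟩ S u hne hdir hu hk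
    obtain ⟨U, hU⟩ : ∃ U : Ideal (PointJoins N), ∀ x, x ∈ U ↔ ∃ I ∈ S, x ∈ I := by
      obtain ⟨I₀, hI₀⟩ := hne
      refine ⟨{ carrier := {x | ∃ I ∈ S, x ∈ I}
                lower' := fun a b hba ⟨I, hI, ha⟩ => ⟨I, hI, I.lower hba ha⟩
                nonempty' := ⟨⊥, I₀, hI₀, I₀.bot_mem⟩
                directed' := ?_ }, fun x => Iff.rfl⟩
      rintro a ⟨I, hI, ha⟩ b ⟨J, hJ, hb⟩
      obtain ⟨T, hT, hIT, hJT⟩ := hdir I hI J hJ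
      exact ⟨a ⊔ b, ⟨T, hT, Ideal.sup_mem (hIT ha) (hJT hb)⟩, le_sup_left, le_sup_right⟩
    have huU : u ≤ U := hu.2 fun I hI x hx => (hU x).2 ⟨I, hI, hx⟩
    obtain ⟨I, hI, hkI⟩ := (hU k).1 (huU (Ideal.principal_le_iff.1 hk))
    exact ⟨I, hI, Ideal.principal_le_iff.2 hkI⟩
  · refine le_antisymm (sSup_le ?_) fun k hk => ?_
    · rintro _ ⟨k, hk, rfl⟩
      exact Ideal.principal_le_iff.2 hk
    · exact Ideal.principal_le_iff.1 (le_sSup ⟨k, hk, rfl⟩)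

/-- A proper subideal of `below p` omits `p`, so its elements are strictly below `p`. The lower
cover `s` itself need not be a finite join of points. -/
theorem PointJoins.lt_below_iff {p s : N} (hs : IsGreatest {x | x < p} s)
    {J : Ideal (PointJoins N)} (hp : IsLatticePoint p) : J < below p ↔ J ≤ below s := by
  constructor
  · intro h k hk
    refine hs.2 (lt_of_le_of_ne (h.le hk) ?_)
    rintro rfl
    exact h.not_ge (Ideal.principal_le_iff.2 hk)
  · intro h
    refine lt_of_le_of_ne (h.trans (below_mono (le_of_lt hs.1))) ?_
    rintro rfl
    exact lt_irrefl p (lt_of_le_of_lt (h (show hp.toPointJoins ∈ below p from le_rfl)) hs.1)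

theorem PointJoins.isLatticePoint_iff {I : Ideal (PointJoins N)} :
    IsLatticePoint I ↔ ∃ p : N, IsLatticePoint p ∧ I = below p := by
  constructor
  · rintro ⟨J, hJ, hmax⟩
    have hJ' : J < I := hJ
    by_contra! h
    -- Otherwise `below p < I`, hence `below p ≤ J`, for every point `p` in `I`.
    refine hJ'.not_ge (ideal_le_of_forall_point fun p hp hpI => ?_)
    have hle : below p ≤ I := (below_coe hp.toPointJoins).trans_le (Ideal.principal_le_iff.2 hpI)
    exact hmax (lt_of_le_of_ne hle (h p hp).symm) (show p ≤ p from le_rfl)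
  · rintro ⟨p, hp, rfl⟩
    obtain ⟨s, hs⟩ := hp
    exact ⟨below s, (lt_below_iff hs ⟨s, hs⟩).2 le_rfl, fun J hJ => (lt_below_iff hs ⟨s, hs⟩).1 hJ⟩

theorem PointJoins.below_finset_sup [IsModularLattice N] (hN : HasMinimalComplements N)
    {ι : Type*} (s : Finset ι) (f : ι → N) {J : Ideal (PointJoins N)}
    (h : ∀ i ∈ s, below (f i) ≤ J) : below (s.sup f) ≤ J := by
  classical
  induction s using Finset.induction_on with
  | empty =>
    intro k hk
    rw [show k = ⊥ from Subtype.ext (le_bot_iff.1 hk)]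
    exact J.bot_mem
  | insert a s _ ih =>
    rw [Finset.sup_insert]
    refine (map_sup (belowHom hN) (f a) (s.sup f)).trans_le (sup_le ?_ ?_)
    · exact h a (Finset.mem_insert_self a s)
    · exact ih fun i hi => h i (Finset.mem_insert_of_mem hi)

/-- A finite join-cover by ideals is refined by a finite set of points. -/
theorem PointJoins.exists_points_of_isJoinCover {p : N} (hp : IsLatticePoint p)
    {X : Finset (Ideal (PointJoins N))} (h : IsJoinCover (below p) X) :
    ∃ F : Finset N, (∀ f ∈ F, ∃ x ∈ X, below f ≤ x) ∧ p ≤ F.sup id := by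
  classical
  obtain ⟨b, hb, hpb⟩ := h
  -- An ideal containing every member of `X`, hence containing their join `b`.
  let U : Ideal (PointJoins N) :=
    { carrier := {k | ∃ F : Finset N, (∀ f ∈ F, ∃ x ∈ X, below f ≤ x) ∧ (k : N) ≤ F.sup id}
      lower' := fun a b hba ⟨F, hF, ha⟩ => ⟨F, hF, le_trans hba ha⟩
      nonempty' := ⟨⊥, ∅, by simp, bot_le⟩
      directed' := by
        rintro a ⟨F, hF, ha⟩ b ⟨G, hG, hb⟩
        refine ⟨a ⊔ b, ⟨F ∪ G, fun f hf => ?_, ?_⟩, le_sup_left, le_sup_right⟩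
        · exact (Finset.mem_union.1 hf).elim (hF f) (hG f)
        · rw [Finset.sup_union]
          exact sup_le_sup ha hb }
  have hbU : b ≤ U := hb.2 fun x hx k hk =>
    ⟨{(k : N)}, by simpa using ⟨x, hx, Ideal.principal_le_iff.2 hk⟩, by simp⟩
  exact hbU (hpb (show hp.toPointJoins ∈ below p from le_rfl))

theorem PointJoins.isStronglySpatial [IsModularLattice N] (hN : HasMinimalComplements N) :
    IsStronglySpatial (Ideal (PointJoins N)) where
  joinDense I := by
    refine ⟨{J | IsLatticePoint J ∧ J ≤ I}, fun J hJ => hJ.1, fun J hJ => hJ.2, fun J hJ => ?_⟩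
    refine ideal_le_of_forall_point fun p hp hpI => ?_
    have hle : below p ≤ I := (below_coe hp.toPointJoins).trans_le (Ideal.principal_le_iff.2 hpI)
    exact hJ ⟨isLatticePoint_iff.2 ⟨p, hp, rfl⟩, hle⟩ (show p ≤ p from le_rfl)
  joinIrreducible I hI := IsLatticePoint.isJoinIrreducible hI
  exists_minimal I hI X hX := by
    classical
    obtain ⟨p, hp, rfl⟩ := isLatticePoint_iff.1 hI
    obtain ⟨F, hF, hpF⟩ := exists_points_of_isJoinCover hp hX
    obtain ⟨g, hgF, hpg, hg⟩ := hN.exists_minimal_family p id F ⊥ (by simpa using hpF)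
    simp only [sup_bot_eq] at hpg hg
    have hpt : ∀ i ∈ F, g i ≠ ⊥ → IsLatticePoint (g i) := by
      intro i hi hne
      refine hp.of_minimal_of_ne_bot ?_ (hg i hi) hne
      rwa [← Finset.sup_insert, Finset.insert_erase hi]
    -- Zero members are dropped: `⊥` is not a point and adds nothing to the join.
    refine ⟨(F.filter fun i => g i ≠ ⊥).image fun i => below (g i), ⟨⟨_, Finset.isLUB_sup_id, ?_⟩, ?_⟩, ?_, ?_⟩
    · refine (below_mono hpg).trans (below_finset_sup hN F g fun i hi => ?_)
      by_cases hne : g i = ⊥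
      · intro k hk
        rw [show k = ⊥ from Subtype.ext (le_bot_iff.1 (hne ▸ hk))]
        exact Ideal.bot_mem _
      · exact Finset.le_sup (f := id)
          (Finset.mem_image_of_mem _ (Finset.mem_filter.2 ⟨hi, hne⟩))
    · rintro Y ⟨b, hb, hpb⟩ hYE e he
      obtain ⟨i, hi, rfl⟩ := Finset.mem_image.1 he
      obtain ⟨hiF, hne⟩ := Finset.mem_filter.1 hi
      by_contra hY
      obtain ⟨s, hs⟩ := hpt i hiF hne
      -- Without `below (g i)`, each member of `Y` lies under the lower cover `s` of `g i` or under
      -- another `g j`, contradicting the minimality of `g i`.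
      have hbs : b ≤ below (s ⊔ (F.erase i).sup g) := by
        refine hb.2 fun y hy => ?_
        obtain ⟨_, hz, hyz⟩ := hYE y hy
        obtain ⟨j, hj, rfl⟩ := Finset.mem_image.1 hz
        by_cases hji : j = i
        · subst hji
          have hlt : y < below (g j) := lt_of_le_of_ne hyz fun e => hY (e ▸ hy)
          exact ((lt_below_iff hs ⟨s, hs⟩).1 hlt).trans (below_mono le_sup_left)
        · refine hyz.trans (below_mono (le_trans ?_ le_sup_right))
          exact Finset.le_sup (Finset.mem_erase.2 ⟨hji, (Finset.mem_filter.1 hj).1⟩)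
      have hle : p ≤ s ⊔ (F.erase i).sup g :=
        hbs (hpb (show hp.toPointJoins ∈ below p from le_rfl))
      have hlt : s < g i := hs.1
      exact hlt.ne (hg i hiF s hlt.le hle)
    · intro e he
      obtain ⟨i, hi, rfl⟩ := Finset.mem_image.1 (Finset.mem_coe.1 he)
      obtain ⟨hiF, hne⟩ := Finset.mem_filter.1 hi
      exact isLatticePoint_iff.2 ⟨g i, hpt i hiF hne, rfl⟩
    · intro e he
      obtain ⟨i, hi, rfl⟩ := Finset.mem_image.1 he
      have hiF := (Finset.mem_filter.1 hi).1
      obtain ⟨x, hx, hix⟩ := hF i hiF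
      exact ⟨x, hx, (below_mono (hgF i hiF)).trans hix⟩

end PointJoins

/-! ### The embedding of `L` -/

/-- The embedding of a lattice into its ideal lattice. -/
def Order.Ideal.principalHom (Q : Type*) [Lattice Q] : LatticeHom Q (Ideal Q) where
  toFun := Ideal.principal
  map_sup' _ _ := le_antisymm
    (Ideal.principal_le_iff.2 ⟨_, Ideal.mem_principal_self, _, Ideal.mem_principal_self, le_rfl⟩)
    (sup_le (Ideal.principal_le_iff.2 (Ideal.mem_principal.2 le_sup_left))
      (Ideal.principal_le_iff.2 (Ideal.mem_principal.2 le_sup_right)))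
  map_inf' _ _ := SetLike.ext fun _ => le_inf_iff

/-- The embedding of a lattice into its filter lattice, the filters being ordered by reverse
inclusion and represented as ideals of the dual lattice. -/
def filterHom (L : Type*) [Lattice L] : LatticeHom L (Ideal Lᵒᵈ)ᵒᵈ :=
  LatticeHom.dual.symm (Order.Ideal.principalHom Lᵒᵈ)

theorem inVarietyOf_dual_ideal (L : Type*) [Lattice L] : InVarietyOf (Ideal Lᵒᵈ)ᵒᵈ L :=
  (inVarietyOf_ideal (Ideal.principalHom Lᵒᵈ) id fun _ => rfl).dual

theorem corollaryC (L : Type u) [Lattice L] [IsModularLattice L] :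
    ∃ (M : Type u) (_ : CompleteLattice M) (f : LatticeHom L M),
      IsAlgebraicLattice M ∧ IsStronglySpatial M ∧ InVarietyOf M L ∧
        Function.Injective f ∧ ∀ z : L, IsBot z → IsBot (f z) := by
  obtain hL | hL := isEmpty_or_nonempty L
  -- The empty lattice satisfies every identity, so `M` must have exactly one element.
  · refine ⟨PUnit, inferInstance, ⟨⟨isEmptyElim, isEmptyElim⟩, isEmptyElim⟩, ?_, ?_, ?_, ?_, ?_⟩
    · exact ⟨fun x => ⟨∅, by simp, rfl⟩⟩
    · have hno : ∀ p : PUnit.{u + 1}, ¬ IsLatticePoint p := fun p ⟨q, hq, _⟩ => lt_irrefl p hq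
      exact ⟨fun a => ⟨∅, by simp, by simp [isLUB_iff_sSup_eq]⟩, fun p hp => (hno p hp).elim,
        fun p hp => (hno p hp).elim⟩
    · exact fun E _ e _ v => rfl
    · exact fun a => isEmptyElim a
    · exact isEmptyElim
  · let N := (Ideal Lᵒᵈ)ᵒᵈ
    have hvar : InVarietyOf N L := inVarietyOf_dual_ideal L
    have : IsModularLattice N := hvar.isModularLattice
    have hN : HasMinimalComplements N := hasMinimalComplements_dual_ideal Lᵒᵈ
    refine ⟨Ideal (PointJoins N), inferInstance, (PointJoins.belowHom hN).comp (filterHom L),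
      PointJoins.isAlgebraicLattice, PointJoins.isStronglySpatial hN,
      (inVarietyOf_ideal (PointJoins.belowHom hN) Subtype.val PointJoins.below_coe).trans hvar, ?_, ?_⟩
    · have key : ∀ a b : L, PointJoins.below (filterHom L a) ≤ PointJoins.below (filterHom L b) →
          a ≤ b := by
        intro a b h
        by_contra hab
        obtain ⟨p, hp, hpa, hpb⟩ := exists_point_dual_ideal (filterHom L a) (OrderDual.toDual b)
          fun hle => hab (Ideal.principal_le_iff.1 hle)
        exact hpb (h (show hp.toPointJoins ∈ PointJoins.below _ from hpa))
      exact fun _ _ h => le_antisymm (key _ _ (le_of_eq h)) (key _ _ (le_of_eq h.symm))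
    · intro z hz
      -- The zero of `N` is the improper filter, which is the principal filter of a least element.
      have hbot : filterHom L z = (⊥ : N) := by
        refine le_bot_iff.1 fun x _ => ?_
        exact hz (OrderDual.ofDual x)
      intro J k hk
      have hk' : (k : N) ≤ filterHom L z := hk
      rw [hbot] at hk'
      rw [show k = ⊥ from Subtype.ext (le_bot_iff.1 hk')]
      exact J.bot_mem
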